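/- For a finite poset $P$ let $\operatorname{Int}(P)$ be the set of pairs $(u,v)\in P^2$ with $u\le v$, ordered by $(u,v)\le(u',v')$ iff $u\le u'$ and $v\le v'$. Let $$\mathbb{D}_P(x,y,\bar y,\bar x)=\sum_{(u,v)\in\operatorname{Int}(P)}x^{a}y^{b}\bar y^{c}\bar x^{d},$$ where, $\lessdot$ denoting the covering relation, $a,b,c,d$ are respectively the numbers of edges of the Hasse diagram of $\operatorname{Int}(P)$ of the forms $(u,v)\lessdot(u',v)$ with $u\lessdot u'\le v$; $(u,v)\lessdot(u,v')$ with $v\lessdot v'$; $(u',v)\lessdot(u,v)$ with $u'\lessdot u$; $(u,v')\lessdot(u,v)$ with $u\le v'\lessdot v$. Let $\operatorname{Tam}_n$ be the Tamari lattice: the set of planar binary trees with $n$ internal vertices and $n+1$ leaves, ordered by the reflexive transitive closure of the rotation that replaces a subtree $(A,(B,C))$ by $((A,B),C)$; its minimum is the right comb and its maximum is the left comb. Put $\mathbb{D}_n=\mathbb{D}_{\operatorname{Tam}_n}$. For $n\ge 1$, the canopy of a tree in $\operatorname{Tam}_n$ is the word of $n+1$ letters whose $i$-th letter is $L$ or $R$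 according to whether the $i$-th leaf from the left is a left or a right child. The canopy word of an interval $(S,T)$ of $\operatorname{Tam}_n$ is the word of length $n+1$ whose $i$-th letter is the pair formed by the $i$-th letters of the canopies of $S$ and $T$. Write $\mathsf{LL}(S,T)$ and $\mathsf{RR}(S,T)$ for the numbers of its letters equal to $(L,L)$ and $(R,R)$ respectively. **Proposition.** For every $n\ge 1$, the joint distribution of the exponents of $(y,\bar y)$ in $\mathbb{D}_n$ coincides with the joint distribution of $(\mathsf{LL},\mathsf{RR})$ over the intervals of $\operatorname{Tam}_n$, once the first letter (always $\mathsf{LL}$) and the last letter (always $\mathsf{RR}$) of each canopy word are discarded. That is, $$\sum_{(S,T)\in\operatorname{Int}(\operatorname{Tam}_n)}y^{\mathsf{LL}(S,T)}\,\bar y^{\,\mathsf{RR}(S,T)}=y\,\bar y\;\mathbb{D}_n(1,y,\bar y,1),$$ and for all $i,j\ge 0$ the number of intervals of $\operatorname{Tam}_n$ whose monomial in $\mathbb{D}_n$ has exponent $i$ in $y$ and $j$ in $\bar y$ equals the number of intervals with $\mathsf{LL}=i+1$ and $\mathsf{RR}=j+1$. -/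

import Mathlib

open MvPolynomial

noncomputable section

/-! ### Posets of intervals and the four-variable valence polynomial -/

/-- The poset of intervals of `P`: pairs `(u, v)` with `u ≤ v`, where `(u, v) ≤ (u', v')` iff
`u ≤ u'` and `v ≤ v'` (the order induced by the product order). -/
abbrev IntervalPoset (P : Type*) [PartialOrder P] : Type _ := {p : P × P // p.1 ≤ p.2}

namespace IntervalPoset

variable {P : Type*} [PartialOrder P]

/-- The minimum `u` of the interval `(u, v)`. -/
def lower (I : IntervalPoset P) : P := I.1.1

/-- The maximum `v` of the interval `(u, v)`. -/
def upper (I : IntervalPoset P) : P := I.1.2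

/-- Exponent of `x`: the number of Hasse edges `(u, v) ⋖ (u', v)` with `u ⋖ u' ≤ v`. -/
def xExp (I : IntervalPoset P) : ℕ :=
  Set.ncard {J : IntervalPoset P | I ⋖ J ∧ lower I ⋖ lower J ∧ upper J = upper I}

/-- Exponent of `y`: the number of Hasse edges `(u, v) ⋖ (u, v')` with `v ⋖ v'`. -/
def yExp (I : IntervalPoset P) : ℕ :=
  Set.ncard {J : IntervalPoset P | I ⋖ J ∧ lower J = lower I ∧ upper I ⋖ upper J}

/-- Exponent of `ȳ`: the number of Hasse edges `(u', v) ⋖ (u, v)` with `u' ⋖ u`. -/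
def ybarExp (I : IntervalPoset P) : ℕ :=
  Set.ncard {J : IntervalPoset P | J ⋖ I ∧ lower J ⋖ lower I ∧ upper J = upper I}

/-- Exponent of `x̄`: the number of Hasse edges `(u, v') ⋖ (u, v)` with `u ≤ v' ⋖ v`. -/
def xbarExp (I : IntervalPoset P) : ℕ :=
  Set.ncard {J : IntervalPoset P | J ⋖ I ∧ lower J = lower I ∧ upper J ⋖ upper I}

end IntervalPoset

open Classical in
/-- The polynomial `𝔻_P(x, y, ȳ, x̄)` of a finite poset `P`; the variables `x, y, ȳ, x̄` are
`X 0, X 1, X 2, X 3` in this order. -/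
def intervalPolynomial (P : Type*) [PartialOrder P] [Fintype P] : MvPolynomial (Fin 4) ℤ :=
  ∑ I : IntervalPoset P,
    X 0 ^ I.xExp * X 1 ^ I.yExp * X 2 ^ I.ybarExp * X 3 ^ I.xbarExp

/-! ### Tamari lattices -/

/-- `Rotation s t`: the planar binary tree `t` is obtained from `s` by one rotation, replacing
somewhere in `s` a subtree `a (b c)` by `(a b) c`. -/
inductive Rotation : BinaryTree Unit → BinaryTree Unit → Prop
  | root (a b c : BinaryTree Unit) :
      Rotation (.node () a (.node () b c)) (.node () (.node () a b) c)
  | left {s t : BinaryTree Unit} (c : BinaryTree Unit) (h : Rotation s t) :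
      Rotation (.node () s c) (.node () t c)
  | right {s t : BinaryTree Unit} (a : BinaryTree Unit) (h : Rotation s t) :
      Rotation (.node () a s) (.node () a t)

/-- The sum, over all vertices, of the size of the left subtree. It is used only to show that the
Tamari relation is antisymmetric. -/
def leftWeight : BinaryTree Unit → ℕ
  | .nil => 0
  | .node _ l r => l.numNodes + leftWeight l + leftWeight r

theorem Rotation.numNodes_eq {s t : BinaryTree Unit} (h : Rotation s t) :
    s.numNodes = t.numNodes := by
  induction h with
  | root a b c => simp only [BinaryTree.numNodes]; omega
  | left c _ ih => simp only [BinaryTree.numNodes]; omega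
  | right a _ ih => simp only [BinaryTree.numNodes]; omega

theorem Rotation.leftWeight_lt {s t : BinaryTree Unit} (h : Rotation s t) :
    leftWeight s < leftWeight t := by
  induction h with
  | root a b c => simp only [leftWeight, BinaryTree.numNodes]; omega
  | left c h ih => have := h.numNodes_eq; simp only [leftWeight]; omega
  | right a _ ih => simp only [leftWeight]; omega

theorem leftWeight_le_of_reflTransGen {s t : BinaryTree Unit}
    (h : Relation.ReflTransGen Rotation s t) : s = t ∨ leftWeight s < leftWeight t := by
  induction h with
  | refl => exact Or.inl rfl
  | tail _ h ih =>
    right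
    rcases ih with rfl | ih
    · exact h.leftWeight_lt
    · exact ih.trans h.leftWeight_lt

/-- The Tamari lattice on planar binary trees with `n` internal vertices (and `n + 1` leaves). -/
def Tamari (n : ℕ) : Type := {t : BinaryTree Unit // t.numNodes = n}

namespace Tamari

/-- The underlying planar binary tree. -/
def tree {n : ℕ} (t : Tamari n) : BinaryTree Unit := t.1

instance (n : ℕ) : Fintype (Tamari n) :=
  Fintype.subtype (BinaryTree.treesOfNumNodesEq n) fun _ => BinaryTree.mem_treesOfNumNodesEq

/-- The Tamari order: the reflexive transitive closure of rotation. -/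
instance (n : ℕ) : PartialOrder (Tamari n) where
  le s t := Relation.ReflTransGen Rotation s.tree t.tree
  le_refl _ := Relation.ReflTransGen.refl
  le_trans _ _ _ := Relation.ReflTransGen.trans
  le_antisymm s t hst hts := by
    rcases leftWeight_le_of_reflTransGen hst with h | h
    · exact Subtype.ext h
    · rcases leftWeight_le_of_reflTransGen hts with h' | h'
      · exact Subtype.ext h'.symm
      · omega

end Tamari

/-! ### Canopies -/

/-- Orientation of a leaf: `L` if it is a left child, `R` if it is a right child. -/
inductive LeafDir
  | L
  | R
  deriving DecidableEq

/-- Orientations, from left to right, of the leaves of a subtree which is itself attached to its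
parent in direction `d`. -/
def leafDirs (d : LeafDir) : BinaryTree Unit → List LeafDir
  | .nil => [d]
  | .node _ l r => leafDirs .L l ++ leafDirs .R r

/-- The canopy of a planar binary tree with at least one vertex: the orientations of its leaves
from left to right (empty, by convention, for the tree without vertices). -/
def canopy : BinaryTree Unit → List LeafDir
  | .nil => []
  | .node _ l r => leafDirs .L l ++ leafDirs .R r

/-- The canopy word of a Tamari interval: its `i`-th letter is the pair of the orientations of the
`i`-th leaves of the minimum and of the maximum. -/
def canopyWord {n : ℕ} (I : IntervalPoset (Tamari n)) : List (LeafDir × LeafDir) :=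
  List.zip (canopy I.lower.tree) (canopy I.upper.tree)

/-- Number of double letters `LL` in the canopy word. -/
def numLL {n : ℕ} (I : IntervalPoset (Tamari n)) : ℕ :=
  (canopyWord I).count (LeafDir.L, LeafDir.L)

/-- Number of double letters `RR` in the canopy word. -/
def numRR {n : ℕ} (I : IntervalPoset (Tamari n)) : ℕ :=
  (canopyWord I).count (LeafDir.R, LeafDir.R)

open Classical in
/-- The generating polynomial `∑ LL^{#LL} RR^{#RR}` over the intervals of the Tamari lattice; the
variables `LL, RR` are `X 0, X 1`. -/
def canopyPolynomial (n : ℕ) : MvPolynomial (Fin 2) ℤ :=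
  ∑ I : IntervalPoset (Tamari n), X 0 ^ numLL I * X 1 ^ numRR I

end

/-!
The two statistics agree interval by interval, up to a shift by one: for every Tamari interval
`I = (S, T)`, `numLL I = I.yExp + 1` and `numRR I = I.ybarExp + 1`.

In any poset, `yExp (u, v)` is the number of upper covers of `v` and `ybarExp (u, v)` is the number
of lower covers of `u`. In the Tamari lattice, covers are the same as rotations, so these are the
number of right edges of `T` and the number of left edges of `S` between internal vertices. A tree
with at least one vertex has one more left leaf than it has right internal edges, and one more right
leaf than it has left internal edges. Finally, a rotation changes the canopy only by turning a left
leaf into a right one. Hence a leaf which is left in `T` is already left in `S`, so that `LL`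
counts the left leaves of `T`, and dually `RR` counts the right leaves of `S`.

The only point that is not immediate is that a rotation is a cover, i.e. that distinct
rotations of a tree are incomparable (`Rotation.eq_of_bracketVector_le`). This uses the vector of
the sizes of left subtrees, read in infix order: it is monotone for the Tamari order, and a rotation
increases exactly one of its entries, namely the one of the right child that moves up.
-/

/-! ### Covers in posets of intervals -/

namespace IntervalPoset

variable {P : Type*} [PartialOrder P]

theorem covBy_of_upper_covBy {I J : IntervalPoset P} (hl : lower J = lower I)
    (hu : upper I ⋖ upper J) : I ⋖ J := by
  refine ⟨lt_of_le_of_ne ⟨hl.ge, hu.le⟩ fun h => hu.ne (congrArg upper h), fun K hIK hKJ => ?_⟩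
  have hK : lower K = lower I := le_antisymm (hKJ.le.1.trans hl.le) hIK.le.1
  rcases hu.eq_or_eq (show upper I ≤ upper K from hIK.le.2) hKJ.le.2 with h | h
  · exact hIK.ne (Subtype.ext (Prod.ext hK.symm h.symm))
  · exact hKJ.ne (Subtype.ext (Prod.ext (hK.trans hl.symm) h))

theorem covBy_of_lower_covBy {I J : IntervalPoset P} (hu : upper J = upper I)
    (hl : lower J ⋖ lower I) : J ⋖ I := by
  refine ⟨lt_of_le_of_ne ⟨hl.le, hu.le⟩ fun h => hl.ne (congrArg lower h), fun K hJK hKI => ?_⟩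
  have hK : upper K = upper I := le_antisymm hKI.le.2 (hu.ge.trans hJK.le.2)
  rcases hl.eq_or_eq (show lower J ≤ lower K from hJK.le.1) hKI.le.1 with h | h
  · exact hJK.ne (Subtype.ext (Prod.ext h.symm (hu.trans hK.symm)))
  · exact hKI.ne (Subtype.ext (Prod.ext h hK))

theorem yExp_eq_ncard (I : IntervalPoset P) : I.yExp = Set.ncard {v | upper I ⋖ v} := by
  refine Set.ncard_congr (fun J _ => upper J) (fun J h => h.2.2) (fun J K hJ hK h => ?_)
    fun v hv => ?_
  · exact Subtype.ext (Prod.ext (hJ.2.1.trans hK.2.1.symm) h)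
  · exact ⟨⟨(lower I, v), le_trans I.2 hv.le⟩, ⟨covBy_of_upper_covBy rfl hv, rfl, hv⟩, rfl⟩

theorem ybarExp_eq_ncard (I : IntervalPoset P) : I.ybarExp = Set.ncard {u | u ⋖ lower I} := by
  refine Set.ncard_congr (fun J _ => lower J) (fun J h => h.2.1) (fun J K hJ hK h => ?_)
    fun u hu => ?_
  · exact Subtype.ext (Prod.ext h (hJ.2.2.trans hK.2.2.symm))
  · exact ⟨⟨(u, upper I), le_trans hu.le I.2⟩, ⟨covBy_of_lower_covBy rfl hu, hu, rfl⟩, rfl⟩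

end IntervalPoset

/-! ### The bracket vector -/

/-- The sizes of the left subtrees of the vertices of a tree, listed in infix order. -/
def bracketVector : BinaryTree Unit → List ℕ
  | .nil => []
  | .node _ l r => bracketVector l ++ l.numNodes :: bracketVector r

theorem length_bracketVector (t : BinaryTree Unit) :
    (bracketVector t).length = t.numNodes := by
  induction t with
  | nil => rfl
  | node _ l r ihl ihr => simp [bracketVector, BinaryTree.numNodes, ihl, ihr]; omega

theorem sum_bracketVector (t : BinaryTree Unit) : (bracketVector t).sum = leftWeight t := by
  induction t with
  | nil => rfl
  | node _ l r ihl ihr => simp [bracketVector, leftWeight, ihl, ihr]; omega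

theorem forall₂_append_iff_of_length_eq {α β : Type*} {R : α → β → Prop} {l₁ l₂ : List α}
    {m₁ m₂ : List β} (h : l₁.length = m₁.length) :
    List.Forall₂ R (l₁ ++ l₂) (m₁ ++ m₂) ↔ List.Forall₂ R l₁ m₁ ∧ List.Forall₂ R l₂ m₂ := by
  induction l₁ generalizing m₁ with
  | nil => cases m₁ <;> simp_all
  | cons a l ih => cases m₁ <;> simp_all [and_assoc]

theorem forall₂_trans {α : Type*} {R : α → α → Prop} (hR : ∀ {a b c}, R a b → R b c → R a c)
    {l m k : List α} (h : List.Forall₂ R l m) (h' : List.Forall₂ R m k) :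
    List.Forall₂ R l k := by
  induction h generalizing k with
  | nil => exact h'
  | cons h _ ih =>
    cases h' with
    | cons h₁ h₂ => exact .cons (hR h h₁) (ih h₂)

theorem Rotation.bracketVector_le {s t : BinaryTree Unit} (h : Rotation s t) :
    List.Forall₂ (· ≤ ·) (bracketVector s) (bracketVector t) := by
  have hrefl : ∀ l : List ℕ, List.Forall₂ (· ≤ ·) l l := fun l => List.forall₂_refl l
  induction h with
  | root a b c =>
    simp only [bracketVector, List.append_assoc, List.cons_append, BinaryTree.numNodes]
    refine List.rel_append (hrefl _) (.cons le_rfl (List.rel_append (hrefl _) (.cons ?_ (hrefl _))))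
    omega
  | left c h ih => exact List.rel_append ih (.cons h.numNodes_eq.le (hrefl _))
  | right a h ih => exact List.rel_append (hrefl _) (.cons le_rfl ih)

theorem bracketVector_le_of_reflTransGen {s t : BinaryTree Unit}
    (h : Relation.ReflTransGen Rotation s t) :
    List.Forall₂ (· ≤ ·) (bracketVector s) (bracketVector t) := by
  induction h with
  | refl => exact List.forall₂_refl _
  | tail _ h ih => exact forall₂_trans (R := (· ≤ ·)) le_trans ih h.bracketVector_le

theorem Rotation.not_bracketVector_ge {s t : BinaryTree Unit} (h : Rotation s t) :
    ¬ List.Forall₂ (· ≤ ·) (bracketVector t) (bracketVector s) := by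
  intro h'
  have := h'.sum_le_sum
  rw [sum_bracketVector, sum_bracketVector] at this
  exact this.not_gt h.leftWeight_lt

theorem bracketVector_node_le_iff {l l' r r' : BinaryTree Unit}
    (h : l.numNodes = l'.numNodes) :
    List.Forall₂ (· ≤ ·) (bracketVector (.node () l r)) (bracketVector (.node () l' r')) ↔
      List.Forall₂ (· ≤ ·) (bracketVector l) (bracketVector l') ∧
        List.Forall₂ (· ≤ ·) (bracketVector r) (bracketVector r') := by
  simp only [bracketVector]
  rw [forall₂_append_iff_of_length_eq (by simp [length_bracketVector, h])]
  simp [h]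

/-- Distinct rotations of the same tree increase distinct entries of the bracket vector, so they
are incomparable. -/
theorem Rotation.eq_of_bracketVector_le {s w t : BinaryTree Unit} (hw : Rotation s w)
    (ht : Rotation s t) (h : List.Forall₂ (· ≤ ·) (bracketVector w) (bracketVector t)) :
    w = t := by
  induction hw generalizing t with
  | root a b c =>
    -- The entry of `node b c` is increased by the root rotation and by no other one.
    have key : ∀ {a' t' : BinaryTree Unit}, a'.numNodes = a.numNodes →
        ((∃ b' c', t' = .node () b' c' ∧ b'.numNodes = b.numNodes) ∨
          ∃ c' d, t' = .node () (.node () b c') d) →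
        ¬ List.Forall₂ (· ≤ ·) (bracketVector (.node () (.node () a b) c))
          (bracketVector (.node () a' t')) := by
      rintro a' t' ha (⟨b', c', rfl, hb⟩ | ⟨c', d, rfl⟩) h
      all_goals
        simp only [bracketVector, List.append_assoc, List.cons_append] at h
        rw [forall₂_append_iff_of_length_eq (by simp [length_bracketVector, ha]),
          List.forall₂_cons,
          forall₂_append_iff_of_length_eq (by simp [length_bracketVector, *]),
          List.forall₂_cons] at h
        have := h.2.2.2.1
        simp only [BinaryTree.numNodes] at this
        omega
    cases ht with
    | root => rfl
    | left _ ha => exact absurd h (key ha.numNodes_eq.symm (.inl ⟨b, c, rfl, rfl⟩))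
    | right _ hbc =>
      refine absurd h (key rfl ?_)
      cases hbc with
      | root _ c d => exact .inr ⟨c, d, rfl⟩
      | left _ hb => exact .inl ⟨_, _, rfl, hb.numNodes_eq.symm⟩
      | right _ hc => exact .inl ⟨_, _, rfl, rfl⟩
  | @left l w' c hw ih =>
    cases ht with
    | root _ b c =>
      simp only [bracketVector, List.append_assoc, List.cons_append] at h
      rw [forall₂_append_iff_of_length_eq (by simp [length_bracketVector, hw.numNodes_eq])] at h
      exact absurd h.1 hw.not_bracketVector_ge
    | left _ ht =>
      rw [bracketVector_node_le_iff (hw.numNodes_eq.symm.trans ht.numNodes_eq)] at h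
      rw [ih ht h.1]
    | right _ ht =>
      rw [bracketVector_node_le_iff hw.numNodes_eq.symm] at h
      exact absurd h.1 hw.not_bracketVector_ge
  | @right a r w' hw ih =>
    cases ht with
    | root _ b c =>
      simp only [bracketVector, List.append_assoc, List.cons_append] at h
      rw [forall₂_append_iff_of_length_eq rfl, List.forall₂_cons] at h
      have h := h.2.2
      cases hw with
      | root _ c d =>
        simp only [bracketVector, List.append_assoc, List.cons_append] at h
        rw [forall₂_append_iff_of_length_eq rfl, List.forall₂_cons,
          forall₂_append_iff_of_length_eq rfl, List.forall₂_cons] at h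
        have := h.2.2.2.1
        simp only [BinaryTree.numNodes] at this
        omega
      | left _ hb =>
        simp only [bracketVector] at h
        rw [forall₂_append_iff_of_length_eq
          (by simp [length_bracketVector, hb.numNodes_eq])] at h
        exact absurd h.1 hb.not_bracketVector_ge
      | right _ hc =>
        simp only [bracketVector] at h
        rw [forall₂_append_iff_of_length_eq rfl, List.forall₂_cons] at h
        exact absurd h.2.2 hc.not_bracketVector_ge
    | left _ ht =>
      rw [bracketVector_node_le_iff ht.numNodes_eq] at h
      exact absurd h.2 hw.not_bracketVector_ge
    | right _ ht =>
      rw [bracketVector_node_le_iff rfl] at h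
      rw [ih ht h.2]

/-! ### Covers in the Tamari lattice -/

namespace Tamari

variable {n : ℕ}

theorem lt_of_rotation {s t : Tamari n} (h : Rotation s.tree t.tree) : s < t := by
  refine lt_of_le_of_ne (Relation.ReflTransGen.single h) ?_
  rintro rfl
  exact h.leftWeight_lt.false

theorem exists_rotation_le_of_lt {s t : Tamari n} (h : s < t) :
    ∃ w : Tamari n, Rotation s.tree w.tree ∧ w ≤ t := by
  rcases Relation.ReflTransGen.cases_head (show Relation.ReflTransGen Rotation _ _ from h.le) with
    h' | ⟨w, hsw, hwt⟩
  · exact absurd (Subtype.ext h') h.ne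
  · exact ⟨⟨w, hsw.numNodes_eq ▸ s.2⟩, hsw, hwt⟩

theorem covBy_iff_rotation {s t : Tamari n} : s ⋖ t ↔ Rotation s.tree t.tree := by
  constructor
  · intro h
    obtain ⟨w, hsw, hwt⟩ := exists_rotation_le_of_lt h.lt
    rcases h.eq_or_eq (lt_of_rotation hsw).le hwt with rfl | rfl
    · exact absurd (lt_of_rotation hsw) (lt_irrefl _)
    · exact hsw
  · refine fun h => ⟨lt_of_rotation h, fun v hsv hvt => ?_⟩
    obtain ⟨w, hsw, hwv⟩ := exists_rotation_le_of_lt hsv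
    have hwt : w < t := hwv.trans_lt hvt
    exact hwt.ne (Subtype.ext
      (hsw.eq_of_bracketVector_le h (bracketVector_le_of_reflTransGen hwt.le)))

theorem ncard_upper_covers (s : Tamari n) :
    Set.ncard {t | s ⋖ t} = Set.ncard {t | Rotation s.tree t} :=
  Set.ncard_congr (fun t _ => t.tree) (fun _ h => covBy_iff_rotation.1 h)
    (fun _ _ _ _ h => Subtype.ext h)
    fun t h => ⟨⟨t, h.numNodes_eq ▸ s.2⟩, covBy_iff_rotation.2 h, rfl⟩

theorem ncard_lower_covers (t : Tamari n) :
    Set.ncard {s | s ⋖ t} = Set.ncard {s | Rotation s t.tree} :=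
  Set.ncard_congr (fun s _ => s.tree) (fun _ h => covBy_iff_rotation.1 h)
    (fun _ _ _ _ h => Subtype.ext h)
    fun s h => ⟨⟨s, h.numNodes_eq.trans t.2⟩, covBy_iff_rotation.2 h, rfl⟩

end Tamari

/-! ### Counting rotations -/

/-- The number of vertices whose right child is a vertex. -/
def numRightEdges : BinaryTree Unit → ℕ
  | .nil => 0
  | .node _ l .nil => numRightEdges l
  | .node _ l (.node _ b c) => numRightEdges l + numRightEdges (.node () b c) + 1

/-- The number of vertices whose left child is a vertex. -/
def numLeftEdges : BinaryTree Unit → ℕ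
  | .nil => 0
  | .node _ .nil r => numLeftEdges r
  | .node _ (.node _ a b) r => numLeftEdges (.node () a b) + numLeftEdges r + 1

theorem Rotation.ne {s t : BinaryTree Unit} (h : Rotation s t) : s ≠ t := by
  rintro rfl
  exact h.leftWeight_lt.false

theorem finite_setOf_rotation_left (s : BinaryTree Unit) : {t | Rotation s t}.Finite :=
  (BinaryTree.treesOfNumNodesEq s.numNodes).finite_toSet.subset fun _ h =>
    BinaryTree.mem_treesOfNumNodesEq.2 h.numNodes_eq.symm

theorem finite_setOf_rotation_right (t : BinaryTree Unit) : {s | Rotation s t}.Finite :=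
  (BinaryTree.treesOfNumNodesEq t.numNodes).finite_toSet.subset fun _ h =>
    BinaryTree.mem_treesOfNumNodesEq.2 h.numNodes_eq

/-- Counting lemma behind the recursions for the numbers of rotations from and to a tree: `A` and
`B` are the sets of rotations inside the left and inside the right subtree. -/
theorem ncard_node_image_union {l r : BinaryTree Unit} {A B : Set (BinaryTree Unit)}
    (hA : A.Finite) (hB : B.Finite) (hl : l ∉ A) :
    Set.ncard ((BinaryTree.node () · r) '' A ∪ (BinaryTree.node () l ·) '' B) =
      A.ncard + B.ncard := by
  rw [Set.ncard_union_eq _ (hA.image _) (hB.image _),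
    Set.ncard_image_of_injective _ fun _ _ h => by simpa using h,
    Set.ncard_image_of_injective _ fun _ _ h => by simpa using h]
  rw [Set.disjoint_left]
  rintro _ ⟨s, hs, rfl⟩ ⟨s', _, h⟩
  simp only [BinaryTree.node.injEq] at h
  exact hl (h.2.1 ▸ hs)

theorem ncard_setOf_rotation_left (s : BinaryTree Unit) :
    Set.ncard {t | Rotation s t} = numRightEdges s := by
  induction s with
  | nil =>
    rw [numRightEdges, Set.ncard_eq_zero (finite_setOf_rotation_left _)]
    exact Set.eq_empty_of_forall_notMem fun _ h => by cases h
  | node _ l r ihl ihr =>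
    have hu := ncard_node_image_union (r := r) (finite_setOf_rotation_left l)
      (finite_setOf_rotation_left r) (fun h => h.ne rfl)
    rw [ihl, ihr] at hu
    cases r with
    | nil =>
      rw [numRightEdges, ← Nat.add_zero (numRightEdges l), ← numRightEdges, ← hu]
      congr 1
      ext t
      constructor
      · intro h
        cases h with
        | left _ h => exact .inl ⟨_, h, rfl⟩
        | right _ h => exact .inr ⟨_, h, rfl⟩
      · rintro (⟨_, h, rfl⟩ | ⟨_, h, rfl⟩)
        exacts [h.left _, h.right _]
    | node _ b c =>
      rw [numRightEdges, ← hu, ← Set.ncard_insert_of_notMem (a := .node () (.node () l b) c) _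
        (((finite_setOf_rotation_left _).image _).union ((finite_setOf_rotation_left _).image _))]
      · congr 1
        ext t
        constructor
        · intro h
          cases h with
          | root => exact .inl rfl
          | left _ h => exact .inr (.inl ⟨_, h, rfl⟩)
          | right _ h => exact .inr (.inr ⟨_, h, rfl⟩)
        · rintro (rfl | ⟨_, h, rfl⟩ | ⟨_, h, rfl⟩)
          exacts [.root _ _ _, h.left _, h.right _]
      · -- Only the root rotation changes the size of the left subtree.
        rintro (⟨l', h, e⟩ | ⟨r', _, e⟩)
        · simp only [BinaryTree.node.injEq] at e
          have := h.numNodes_eq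
          rw [e.2.1] at this
          simp only [BinaryTree.numNodes] at this
          omega
        · simp only [BinaryTree.node.injEq] at e
          have := congrArg BinaryTree.numNodes e.2.1
          simp only [BinaryTree.numNodes] at this
          omega

theorem ncard_setOf_rotation_right (t : BinaryTree Unit) :
    Set.ncard {s | Rotation s t} = numLeftEdges t := by
  induction t with
  | nil =>
    rw [numLeftEdges, Set.ncard_eq_zero (finite_setOf_rotation_right _)]
    exact Set.eq_empty_of_forall_notMem fun _ h => by cases h
  | node _ l r ihl ihr =>
    have hu := ncard_node_image_union (r := r) (finite_setOf_rotation_right l)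
      (finite_setOf_rotation_right r) (fun h => h.ne rfl)
    rw [ihl, ihr] at hu
    cases l with
    | nil =>
      rw [numLeftEdges, ← Nat.zero_add (numLeftEdges r), ← numLeftEdges, ← hu]
      congr 1
      ext t
      constructor
      · intro h
        cases h with
        | left _ h => exact .inl ⟨_, h, rfl⟩
        | right _ h => exact .inr ⟨_, h, rfl⟩
      · rintro (⟨_, h, rfl⟩ | ⟨_, h, rfl⟩)
        exacts [h.left _, h.right _]
    | node _ a b =>
      rw [numLeftEdges, ← hu, ← Set.ncard_insert_of_notMem (a := .node () a (.node () b r)) _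
        (((finite_setOf_rotation_right _).image _).union
          ((finite_setOf_rotation_right _).image _))]
      · congr 1
        ext t
        constructor
        · intro h
          cases h with
          | root => exact .inl rfl
          | left _ h => exact .inr (.inl ⟨_, h, rfl⟩)
          | right _ h => exact .inr (.inr ⟨_, h, rfl⟩)
        · rintro (rfl | ⟨_, h, rfl⟩ | ⟨_, h, rfl⟩)
          exacts [.root _ _ _, h.left _, h.right _]
      · -- Only the root rotation changes the size of the left subtree.
        rintro (⟨l', h, e⟩ | ⟨r', _, e⟩)
        · simp only [BinaryTree.node.injEq] at e
          have := h.numNodes_eq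
          rw [e.2.1] at this
          simp only [BinaryTree.numNodes] at this
          omega
        · simp only [BinaryTree.node.injEq] at e
          have := congrArg BinaryTree.numNodes e.2.1
          simp only [BinaryTree.numNodes] at this
          omega

/-! ### Canopies -/

theorem count_L_leafDirs (t : BinaryTree Unit) :
    (leafDirs .L t).count .L = numRightEdges t + 1 := by
  induction t with
  | nil => rfl
  | node _ l r ihl ihr =>
    cases r with
    | nil => simp [leafDirs, numRightEdges, ihl]
    | node _ b c =>
      -- The direction passed to `leafDirs` only matters for the tree without vertices.
      change (leafDirs .L l ++ leafDirs .L (.node () b c)).count .L = _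
      rw [List.count_append, ihl, ihr, numRightEdges]
      ring

theorem count_R_leafDirs (t : BinaryTree Unit) :
    (leafDirs .R t).count .R = numLeftEdges t + 1 := by
  induction t with
  | nil => rfl
  | node _ l r ihl ihr =>
    cases l with
    | nil => simp [leafDirs, numLeftEdges, ihr]
    | node _ a b =>
      change (leafDirs .R (.node () a b) ++ leafDirs .R r).count .R = _
      rw [List.count_append, ihl, ihr, numLeftEdges]
      ring

theorem canopy_eq_leafDirs {t : BinaryTree Unit} (ht : t ≠ .nil) (d : LeafDir) :
    canopy t = leafDirs d t := by
  cases t with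
  | nil => exact absurd rfl ht
  | node => rfl

/-- The order `L ≤ R` on orientations of leaves. -/
def LeafDir.Le (a b : LeafDir) : Prop := b = .L → a = .L

theorem forall₂_leafDirs_refl (l : List LeafDir) : List.Forall₂ LeafDir.Le l l :=
  List.forall₂_same.2 fun _ _ h => h

theorem forall₂_leafDirs_L_R (t : BinaryTree Unit) :
    List.Forall₂ LeafDir.Le (leafDirs .L t) (leafDirs .R t) := by
  cases t with
  | nil => exact .cons (fun _ => rfl) .nil
  | node => exact forall₂_leafDirs_refl _

theorem Rotation.forall₂_leafDirs {s t : BinaryTree Unit} (h : Rotation s t) (d : LeafDir) :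
    List.Forall₂ LeafDir.Le (leafDirs d s) (leafDirs d t) := by
  induction h generalizing d with
  | root a b c =>
    simp only [leafDirs, List.append_assoc]
    exact List.rel_append (forall₂_leafDirs_refl _)
      (List.rel_append (forall₂_leafDirs_L_R b) (forall₂_leafDirs_refl _))
  | left c _ ih => exact List.rel_append (ih _) (forall₂_leafDirs_refl _)
  | right a _ ih => exact List.rel_append (forall₂_leafDirs_refl _) (ih _)

theorem forall₂_leafDirs_of_reflTransGen {s t : BinaryTree Unit}
    (h : Relation.ReflTransGen Rotation s t) (d : LeafDir) :
    List.Forall₂ LeafDir.Le (leafDirs d s) (leafDirs d t) := by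
  induction h with
  | refl => exact forall₂_leafDirs_refl _
  | tail _ h ih => exact forall₂_trans (fun h₁ h₂ h => h₁ (h₂ h)) ih (h.forall₂_leafDirs d)

theorem count_LL_zip {l m : List LeafDir} (h : List.Forall₂ LeafDir.Le l m) :
    (List.zip l m).count (.L, .L) = m.count .L := by
  induction h with
  | nil => rfl
  | @cons a b _ _ h _ ih => cases a <;> cases b <;> simp_all [LeafDir.Le]

theorem count_RR_zip {l m : List LeafDir} (h : List.Forall₂ LeafDir.Le l m) :
    (List.zip l m).count (.R, .R) = l.count .R := by
  induction h with
  | nil => rfl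
  | @cons a b _ _ h _ ih => cases a <;> cases b <;> simp_all [LeafDir.Le]

/-! ### The statistics of a Tamari interval -/

theorem Tamari.tree_ne_nil {n : ℕ} (hn : 1 ≤ n) (t : Tamari n) : t.tree ≠ .nil := by
  intro h
  have : t.tree.numNodes = n := t.2
  rw [h, BinaryTree.numNodes] at this
  omega

theorem forall₂_canopy {n : ℕ} (hn : 1 ≤ n) (I : IntervalPoset (Tamari n)) :
    List.Forall₂ LeafDir.Le (canopy I.lower.tree) (canopy I.upper.tree) := by
  rw [canopy_eq_leafDirs (Tamari.tree_ne_nil hn _) .L,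
    canopy_eq_leafDirs (Tamari.tree_ne_nil hn _) .L]
  exact forall₂_leafDirs_of_reflTransGen I.2 _

theorem numLL_eq_yExp_add_one {n : ℕ} (hn : 1 ≤ n) (I : IntervalPoset (Tamari n)) :
    numLL I = I.yExp + 1 := by
  rw [numLL, canopyWord, count_LL_zip (forall₂_canopy hn I),
    canopy_eq_leafDirs (Tamari.tree_ne_nil hn _) .L, count_L_leafDirs, IntervalPoset.yExp_eq_ncard,
    Tamari.ncard_upper_covers, ncard_setOf_rotation_left]

theorem numRR_eq_ybarExp_add_one {n : ℕ} (hn : 1 ≤ n) (I : IntervalPoset (Tamari n)) :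
    numRR I = I.ybarExp + 1 := by
  rw [numRR, canopyWord, count_RR_zip (forall₂_canopy hn I),
    canopy_eq_leafDirs (Tamari.tree_ne_nil hn _) .R, count_R_leafDirs, IntervalPoset.ybarExp_eq_ncard,
    Tamari.ncard_lower_covers, ncard_setOf_rotation_right]

theorem mainTheorem5 (n : ℕ) (hn : 1 ≤ n) :
    (canopyPolynomial n =
      X 0 * X 1 *
        aeval (![1, X 0, X 1, 1] : Fin 4 → MvPolynomial (Fin 2) ℤ)
          (intervalPolynomial (Tamari n))) ∧
    ∀ i j : ℕ,
      Set.ncard {I : IntervalPoset (Tamari n) | I.yExp = i ∧ I.ybarExp = j} =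
        Set.ncard {I : IntervalPoset (Tamari n) | numLL I = i + 1 ∧ numRR I = j + 1} := by
  refine ⟨?_, fun i j => ?_⟩
  · rw [canopyPolynomial, intervalPolynomial, map_sum, Finset.mul_sum]
    refine Finset.sum_congr rfl fun I _ => ?_
    rw [numLL_eq_yExp_add_one hn, numRR_eq_ybarExp_add_one hn]
    simp only [map_mul, map_pow, aeval_X, Matrix.cons_val, one_pow, one_mul, mul_one]
    ring
  · simp only [numLL_eq_yExp_add_one hn, numRR_eq_ybarExp_add_one hn, Nat.add_right_cancel_iff]
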